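/- Let $\sigma\ge 0$ and let $f\in L^1_{\mathrm{loc}}(\mathbb R)$ satisfy $f(t+1)=f(t)$ and $f(t)-\sigma>0$ for almost every $t$. Let $$\Phi(t)=\inf\Big\{s>t:\ e^{\sigma t}\le\int_t^{s}(f(u)-\sigma)e^{\sigma u}\,du\Big\}$$ be the firing map of the leaky integrate-and-fire model $\dot x=-\sigma x+f(t)$ (threshold $1$, reset $0$), let $\varphi=\Phi \bmod 1$ be the firing phase map on $S^1=\mathbb R/\mathbb Z$, let $\mathrm{ISI}_n(t)=\Phi^n(t)-\Phi^{n-1}(t)$ for $n\ge 1$, and let $\Psi(t)=\Phi(t)-t$. Assume that the rotation number $\varrho=\lim_{n\to\infty}\Phi^n(t)/n$ is irrational. Then there is a continuous non-decreasing $\Gamma:\mathbb R\to\mathbb R$ with $\Gamma(t+1)=\Gamma(t)+1$ and $\Gamma(\Phi(t))=\Gamma(t)+\varrho$, that is, a lift of a map $\gamma:S^1\to S^1$ (semi-)conjugating $\varphi$ with the rotation by $\varrho$; and $\varphi$ has a unique minimal set $\Delta\subset S^1$ (minimal among the nonempty closed sets $C$ with $\varphi(C)\subset C$). Let $\Gamma$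 be any such lift and let $\widetilde\Delta\subset\mathbb R$ be the total lift of $\Delta$. Call $\varphi$ transitive if it has a dense orbit $\{\varphi^n(z):n\ge 0\}$. (If $f\in C^2(\mathbb R)$ and $f(t)-\sigma>0$ for all $t$, then $\varphi$ is transitive.) 1) If $\varphi$ is transitive, then $\Gamma$ is bijective, $\mathcal S=\Psi([0,1])$ is a compact interval (possibly a point), $$\mathcal S=\Psi([0,1])=\Omega([0,1]),\qquad \Omega(t)=\Gamma^{-1}(t+\varrho)-\Gamma^{-1}(t),$$ and for every $t_0\in\mathbb R$ the set $\{\mathrm{ISI}_n(t_0):n\ge1\}$ is a dense subset of $\mathcal S$. 2) If $\varphi$ is not transitive, then for every $t_0\in\widetilde\Delta$ the set $\{\mathrm{ISI}_n(t_0):n\ge1\}$ is a dense subset of $\widehat{\mathcal S}=\Psi(\widetilde\Delta)$. Moreover, there is a set $\widehat\Delta\subset\Delta$ with $\varphi(\widehat\Delta)=\widehat\Delta$ that $\gamma$ maps bijectively onto $S^1$. For every nonempty $\widehat\Delta\subset\Delta$ with $\varphi(\widehat\Delta)\subset\widehat\Delta$ on which $\gamma$ is injective, let $\widehat\Delta_0\subset[0,1]$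 be its lift to $[0,1]$, let $\widehat\Gamma$ be the restriction of $\Gamma$ to the total lift of $\widehat\Delta$, and let $\widehat\Omega(s)=\widehat\Gamma^{-1}(s+\varrho)-\widehat\Gamma^{-1}(s)$; then $\widehat\Omega(\Gamma(\widehat\Delta_0))=\Psi(\widehat\Delta_0)$, this set is a dense subset of $\widehat{\mathcal S}$, and if $\gamma(\widehat\Delta)=S^1$ it differs from $\widehat{\mathcal S}$ by at most countably many points. Finally, for every $t_0\in\mathbb R\setminus\widetilde\Delta$ and every $t\in\widetilde\Delta$ there is a strictly increasing sequence $(n_k)$ of natural numbers such that for every $l\ge 1$ $$\lim_{k\to\infty}\mathrm{ISI}_l(\Phi^{n_k}(t_0))=\lim_{k\to\infty}\big(\Phi^{n_k+l}(t_0)-\Phi^{n_k+l-1}(t_0)\big)=\Phi^l(t)-\Phi^{l-1}(t)=\mathrm{ISI}_l(t).$$ -/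

import Mathlib

open MeasureTheory Filter Topology Set

noncomputable section

namespace LIF

/-- Firing map of `x' = -σ x + f(t)` (threshold `1`, reset `0`), for locally integrable `f`. -/
def firingMap (σ : ℝ) (f : ℝ → ℝ) (t : ℝ) : ℝ :=
  sInf {s : ℝ | t < s ∧ Real.exp (σ * t) ≤ ∫ u in t..s, (f u - σ) * Real.exp (σ * u)}

/-- The circle map `F mod 1` induced by `F : ℝ → ℝ`; points of the circle `ℝ / ℤ` are
represented by `t ∈ [0, 1)`, which is immaterial when `F (t + 1) = F t + 1`. -/
def circleMap (F : ℝ → ℝ) (z : UnitAddCircle) : UnitAddCircle :=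
  ((F (AddCircle.equivIco 1 0 z : ℝ) : ℝ) : UnitAddCircle)

/-- The firing phase map `φ` on the circle. -/
def phaseMap (σ : ℝ) (f : ℝ → ℝ) : UnitAddCircle → UnitAddCircle :=
  circleMap (firingMap σ f)

/-- `ISI_n(t) = Φ^n(t) - Φ^{n-1}(t)`, meant for `n ≥ 1`. -/
def isi (Φ : ℝ → ℝ) (n : ℕ) (t : ℝ) : ℝ :=
  Φ^[n] t - Φ^[n - 1] t

/-- The set of values of the sequence `ISI_n(t)`, `n ≥ 1`. -/
def isiValues (Φ : ℝ → ℝ) (t : ℝ) : Set ℝ :=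
  {y | ∃ n : ℕ, 1 ≤ n ∧ y = isi Φ n t}

/-- The displacement function `Ψ(t) = Φ(t) - t`. -/
def displacement (Φ : ℝ → ℝ) (t : ℝ) : ℝ :=
  Φ t - t

/-- `ρ` is the rotation number of the lift `Φ`. -/
def IsRotationNumber (Φ : ℝ → ℝ) (ρ : ℝ) : Prop :=
  ∀ t : ℝ, Tendsto (fun n : ℕ => Φ^[n] t / (n : ℝ)) atTop (𝓝 ρ)

/-- `Γ` is a lift of a continuous monotone degree one circle map (semi-)conjugating the circle map
with lift `Φ` to the rotation by `ρ`. -/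
structure IsSemiconjLift (Φ : ℝ → ℝ) (ρ : ℝ) (Γ : ℝ → ℝ) : Prop where
  continuous : Continuous Γ
  monotone : Monotone Γ
  map_add_one : ∀ t, Γ (t + 1) = Γ t + 1
  semiconj : ∀ t, Γ (Φ t) = Γ t + ρ

/-- Topological transitivity: some orbit is dense. -/
def IsTransitive {X : Type*} [TopologicalSpace X] (φ : X → X) : Prop :=
  ∃ z : X, Dense (range fun n : ℕ => φ^[n] z)

/-- `Δ` is a minimal set of `φ`: minimal among the nonempty closed invariant sets. -/
structure IsMinimalSet {X : Type*} [TopologicalSpace X] (φ : X → X) (Δ : Set X) : Prop where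
  nonempty : Δ.Nonempty
  isClosed : IsClosed Δ
  mapsTo : MapsTo φ Δ Δ
  minimal : ∀ C : Set X, C ⊆ Δ → C.Nonempty → IsClosed C → MapsTo φ C C → C = Δ

/-- The total lift to `ℝ` of a subset of the circle. -/
def totalLift (A : Set UnitAddCircle) : Set ℝ :=
  {t : ℝ | (t : UnitAddCircle) ∈ A}

/-- The lift to `[0, 1]` of a subset of the circle. -/
def unitLift (A : Set UnitAddCircle) : Set ℝ :=
  totalLift A ∩ Icc 0 1

/-- `Ω(s) = Γ⁻¹(s + ρ) - Γ⁻¹(s)`, where `Γ⁻¹` is the inverse of the restriction of `Γ` to the set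
`D` (used only where `Γ` is injective on `D`, at `s` with `s` and `s + ρ` in `Γ(D)`). -/
def omegaOn (Γ : ℝ → ℝ) (ρ : ℝ) (D : Set ℝ) (s : ℝ) : ℝ :=
  Function.invFunOn Γ D (s + ρ) - Function.invFunOn Γ D s

/-- `A` is a dense subset of `S`. -/
def DenseSubset (A S : Set ℝ) : Prop :=
  A ⊆ S ∧ S ⊆ closure A

end LIF

end

namespace LIF

/-! ### Arithmetic of irrational rotations -/

/-! Let P be the primitive of `(f u - σ) * exp (σ * u)`. It is strictly increasing and continuous,
and the firing map Φ satisfies P(Φ(t)) = P(t) + exp(σt) (`firingPrimitive_firingMap`). Hence Φ lifts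
a circle homeomorphism, and Poincaré's theorem provides Γ.

Everything else about ISI values rests on the set K = `growthSet Γ`. Since Γ turns Φ into
translation by ρ, and the numbers nρ + m with n large are dense, every forward orbit accumulates
modulo 1 at every point of K (`exists_iterate_mem_Ioo`). So K is contained in every nonempty closed
invariant set and is the lift of the unique minimal set, whichever Γ is chosen. Because `isi Φ (n +
1) t` is the displacement at `Φ^[n] t`, and displacement is continuous and 1-periodic, accumulation
of orbits becomes density of interspike intervals and convergence along subsequences. Transitivity
amounts to injectivity of Γ, that is, to K = ℝ. Where Γ is injective on an invariant set, Ω ∘ Γ = Ψ;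
a section of Γ inside K misses only one-sidedly isolated points of K, which are countable.

For smooth input, injectivity of Γ is Denjoy's theorem. The functional equation expresses log-ratios
of lengths under Φ as p(ξ) - q(ζ) with Lipschitz p, q, so comparing an interval with its closest
return bounds the distortion and excludes wandering intervals. -/

theorem exists_nat_abs_mul_sub_lt (ρ : ℝ) {ε : ℝ} (hε : 0 < ε) :
    ∃ n : ℕ, 0 < n ∧ ∃ j : ℤ, |n * ρ - j| < ε := by
  obtain ⟨N, hN⟩ := exists_nat_one_div_lt hε
  obtain ⟨j, k, hk, -, h⟩ := Real.exists_int_int_abs_mul_sub_le ρ (Nat.succ_pos N)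
  lift k to ℕ using hk.le
  refine ⟨k, by exact_mod_cast hk, j, lt_of_le_of_lt ?_ hN⟩
  calc _ ≤ 1 / ((Nat.succ N : ℝ) + 1) := by exact_mod_cast h
    _ ≤ _ := by
      apply one_div_le_one_div_of_le (by positivity)
      push_cast; linarith

theorem eq_of_mul_add_eq {ρ : ℝ} (hρ : Irrational ρ) {n n' m m' : ℤ}
    (h : n * ρ + m = n' * ρ + m') : n = n' ∧ m = m' := by
  have hn : n = n' := by
    by_contra hne
    have h0 : ((n - n' : ℤ) : ℝ) ≠ 0 := by exact_mod_cast sub_ne_zero.mpr hne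
    refine hρ ⟨((m' - m : ℤ) : ℚ) / ((n - n' : ℤ) : ℚ), ?_⟩
    push_cast at h0 ⊢
    rw [div_eq_iff h0]
    linarith
  subst hn
  exact ⟨rfl, by exact_mod_cast add_left_cancel h⟩

/-- Some δ = qρ - j is nonzero and shorter than the interval. Starting at Nρ + m on the appropriate
side, steps of size |δ| cannot jump over the interval. Starting at N makes the time as late as
desired, which forward orbits need. -/
theorem exists_nat_int_mem_Ioo {ρ : ℝ} (hρ : Irrational ρ) (N : ℕ) {x y : ℝ} (hxy : x < y) :
    ∃ n : ℕ, N ≤ n ∧ ∃ m : ℤ, x < n * ρ + m ∧ n * ρ + m < y := by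
  obtain ⟨q, hq, j, hj⟩ := exists_nat_abs_mul_sub_lt ρ (sub_pos.mpr hxy)
  set δ := q * ρ - j with hδ
  have hδ0 : δ ≠ 0 := by
    intro h
    have := eq_of_mul_add_eq hρ (n := q) (m := -j) (n' := 0) (m' := 0) (by push_cast; linarith)
    omega
  rcases lt_or_gt_of_ne hδ0 with hneg | hpos
  · obtain ⟨m, hm⟩ := exists_int_gt (y - N * ρ)
    set z := N * ρ + m with hz
    have h0 : 0 ≤ (z - y) / -δ := div_nonneg (by linarith) (by linarith)
    set k := ⌊(z - y) / -δ⌋₊ + 1 with hk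
    refine ⟨N + k * q, by omega, m - k * j, ?_⟩
    have e : ((N + k * q : ℕ) : ℝ) * ρ + ((m - k * j : ℤ) : ℝ) = z + k * δ := by
      push_cast; rw [hδ, hz]; ring
    rw [e]
    have h1 := Nat.floor_le h0
    have h2 := Nat.lt_floor_add_one ((z - y) / -δ)
    rw [le_div_iff₀ (by linarith)] at h1
    rw [div_lt_iff₀ (by linarith)] at h2
    rw [abs_of_neg hneg] at hj
    rw [hk]; push_cast
    constructor <;> nlinarith
  · obtain ⟨m, hm⟩ := exists_int_lt (x - N * ρ)
    set z := N * ρ + m with hz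
    have h0 : 0 ≤ (x - z) / δ := div_nonneg (by linarith) (by linarith)
    set k := ⌊(x - z) / δ⌋₊ + 1 with hk
    refine ⟨N + k * q, by omega, m - k * j, ?_⟩
    have e : ((N + k * q : ℕ) : ℝ) * ρ + ((m - k * j : ℤ) : ℝ) = z + k * δ := by
      push_cast; rw [hδ, hz]; ring
    rw [e]
    have h1 := Nat.floor_le h0
    have h2 := Nat.lt_floor_add_one ((x - z) / δ)
    rw [le_div_iff₀ (by linarith)] at h1
    rw [div_lt_iff₀ (by linarith)] at h2
    rw [abs_of_pos hpos] at hj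
    rw [hk]; push_cast
    constructor <;> nlinarith

/-- An irrational rotation has arbitrarily late closest returns. -/
theorem exists_closest_return {ρ : ℝ} (hρ : Irrational ρ) (N : ℕ) :
    ∃ n : ℕ, N < n ∧ ∃ m : ℤ, |n * ρ - m| < 1 ∧
      ∀ i : ℕ, 0 < i → i < n → ∀ k : ℤ, |n * ρ - m| < |i * ρ - k| := by
  classical
  -- No return before time N is closer than ε, so the first time with a return closer than ε exceeds
  -- N and beats every earlier return.
  have hε : ∃ ε : ℝ, 0 < ε ∧ ε ≤ 1 ∧ ∀ i : ℕ, 0 < i → i ≤ N → ∀ k : ℤ, ε ≤ |i * ρ - k| := by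
    induction N with
    | zero => exact ⟨1, one_pos, le_rfl, fun i hi hi' => by omega⟩
    | succ N ih =>
      obtain ⟨ε, h0, h1, h⟩ := ih
      set r := |((N + 1 : ℕ) : ℝ) * ρ - round (((N + 1 : ℕ) : ℝ) * ρ)| with hr
      have hr0 : 0 < r := by
        rw [hr, abs_pos]
        intro h
        have := eq_of_mul_add_eq hρ (n := (N + 1 : ℕ)) (m := -round (((N + 1 : ℕ) : ℝ) * ρ))
          (n' := 0) (m' := 0) (by push_cast at h ⊢; linarith)
        omega
      refine ⟨min ε r, lt_min h0 hr0, (min_le_left _ _).trans h1, fun i hi hi' k => ?_⟩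
      rcases Nat.lt_or_ge N i with hlt | hge
      · obtain rfl : i = N + 1 := by omega
        exact (min_le_right _ _).trans (round_le _ _)
      · exact (min_le_left _ _).trans (h i hi hge k)
  obtain ⟨ε, h0, h1, h⟩ := hε
  have hex := exists_nat_abs_mul_sub_lt ρ h0
  obtain ⟨hn, m, hm⟩ := Nat.find_spec hex
  set n := Nat.find hex with hndef
  refine ⟨n, ?_, m, hm.trans_le h1, fun i hi hin k => hm.trans_le ?_⟩
  · by_contra hle
    exact absurd hm (not_lt.mpr (h n hn (not_lt.mp hle) m))
  · by_contra hlt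
    exact Nat.find_min hex hin ⟨hi, k, not_le.mp hlt⟩

/-! ### Lifts of degree one circle maps -/

/-- `Φ` is a lift of an orientation preserving circle homeomorphism. -/
structure IsCircleHomeoLift (Φ : ℝ → ℝ) : Prop where
  continuous : Continuous Φ
  strictMono : StrictMono Φ
  map_add_one : ∀ t, Φ (t + 1) = Φ t + 1

theorem map_add_int_of_map_add_one_const {F : ℝ → ℝ} {κ : ℝ} (h : ∀ t, F (t + 1) = F t + κ)
    (t : ℝ) (m : ℤ) : F (t + m) = F t + m * κ := by
  induction m using Int.induction_on with
  | zero => simp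
  | succ i ih => push_cast at ih ⊢; rw [← add_assoc, h, ih]; ring
  | pred i ih =>
    have := h (t + (-(i : ℝ) - 1))
    push_cast at ih ⊢
    rw [show t + (-(i : ℝ) - 1) + 1 = t + -i by ring, ih] at this
    linarith

theorem map_add_int_of_map_add_one {F : ℝ → ℝ} (h : ∀ t, F (t + 1) = F t + 1) (t : ℝ) (m : ℤ) :
    F (t + m) = F t + m := by
  rw [map_add_int_of_map_add_one_const h, mul_one]

theorem iterate_add_one {F : ℝ → ℝ} (h : ∀ t, F (t + 1) = F t + 1) (n : ℕ) (t : ℝ) :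
    F^[n] (t + 1) = F^[n] t + 1 :=
  ((show Function.Semiconj (· + 1) F F from fun t => (h t).symm).iterate_right n t).symm

theorem coe_eq_coe_iff_exists_int {s t : ℝ} :
    (s : UnitAddCircle) = (t : UnitAddCircle) ↔ ∃ m : ℤ, s = t + m := by
  rw [← sub_eq_zero, ← AddCircle.coe_sub, AddCircle.coe_eq_zero_iff]
  refine exists_congr fun m => ?_
  rw [zsmul_eq_mul, mul_one, eq_sub_iff_add_eq, eq_comm, add_comm]

theorem circleMap_coe {F : ℝ → ℝ} (h : ∀ t, F (t + 1) = F t + 1) (t : ℝ) :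
    circleMap F (t : UnitAddCircle) = (F t : UnitAddCircle) := by
  unfold circleMap
  have e : ((AddCircle.equivIco 1 0 (t : UnitAddCircle) : ℝ)) = t + ((-⌊t⌋ : ℤ) : ℝ) := by
    rw [AddCircle.coe_equivIco_mk_apply (1 : ℝ) t]
    simp [Int.fract, sub_eq_add_neg]
  rw [e, map_add_int_of_map_add_one h]
  exact coe_eq_coe_iff_exists_int.mpr ⟨_, rfl⟩

theorem circleMap_iterate_coe {F : ℝ → ℝ} (h : ∀ t, F (t + 1) = F t + 1) (n : ℕ) (t : ℝ) :
    (circleMap F)^[n] (t : UnitAddCircle) = (F^[n] t : UnitAddCircle) :=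
  ((show Function.Semiconj (fun t : ℝ => (t : UnitAddCircle)) F (circleMap F) from
    fun t => (circleMap_coe h t).symm).iterate_right n t).symm

theorem surjective_of_continuous_monotone {F : ℝ → ℝ} (hc : Continuous F) (hm : Monotone F)
    (h : ∀ t, F (t + 1) = F t + 1) : Function.Surjective F :=
  (CircleDeg1Lift.continuous_iff_surjective ⟨⟨F, hm⟩, h⟩).mp hc

theorem IsCircleHomeoLift.surjective {Φ : ℝ → ℝ} (hΦ : IsCircleHomeoLift Φ) :
    Function.Surjective Φ :=
  surjective_of_continuous_monotone hΦ.continuous hΦ.strictMono.monotone hΦ.map_add_one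

theorem IsSemiconjLift.surjective {Φ Γ : ℝ → ℝ} {ρ : ℝ} (hΓ : IsSemiconjLift Φ ρ Γ) :
    Function.Surjective Γ :=
  surjective_of_continuous_monotone hΓ.continuous hΓ.monotone hΓ.map_add_one

theorem IsSemiconjLift.map_iterate {Φ Γ : ℝ → ℝ} {ρ : ℝ} (hΓ : IsSemiconjLift Φ ρ Γ) (n : ℕ)
    (t : ℝ) : Γ (Φ^[n] t) = Γ t + n * ρ := by
  induction n with
  | zero => simp
  | succ n ih => rw [Function.iterate_succ_apply', hΓ.semiconj, ih]; push_cast; ring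

theorem IsSemiconjLift.map_iterate_add_int {Φ Γ : ℝ → ℝ} {ρ : ℝ} (hΓ : IsSemiconjLift Φ ρ Γ)
    (n : ℕ) (m : ℤ) (t : ℝ) : Γ (Φ^[n] t + m) = Γ t + (n * ρ + m) := by
  rw [map_add_int_of_map_add_one hΓ.map_add_one, hΓ.map_iterate, add_assoc]

/-- Poincaré's theorem: a circle homeomorphism with irrational rotation number is semi-conjugate
to a rotation. -/
theorem IsCircleHomeoLift.exists_isSemiconjLift {Φ : ℝ → ℝ} (hΦ : IsCircleHomeoLift Φ) {ρ : ℝ}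
    (hrot : IsRotationNumber Φ ρ) (hρ : Irrational ρ) : ∃ Γ : ℝ → ℝ, IsSemiconjLift Φ ρ Γ := by
  let g : CircleDeg1Lift := ⟨⟨Φ, hΦ.strictMono.monotone⟩, hΦ.map_add_one⟩
  have hg : g.translationNumber = ρ := by
    refine tendsto_nhds_unique g.tendsto_translation_number₀ ?_
    simp only [CircleDeg1Lift.coe_pow]
    exact hrot 0
  let r : CircleDeg1Lift := CircleDeg1Lift.translate (Multiplicative.ofAdd ρ)
  have hr : ∀ x, r x = ρ + x := CircleDeg1Lift.translate_apply ρ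
  obtain ⟨Γ, hΓ⟩ := CircleDeg1Lift.semiconj_of_bijective_of_translationNumber_eq (f₁ := g) (f₂ := r)
    ⟨hΦ.strictMono.injective, hΦ.surjective⟩
    ⟨fun x y h => by simpa [hr] using h, fun y => ⟨y - ρ, by simp [hr]⟩⟩
    (hg.trans (CircleDeg1Lift.translationNumber_translate ρ).symm)
  have hs : ∀ t, Γ (Φ t) = Γ t + ρ := fun t => by rw [add_comm, ← hr]; exact hΓ t
  have hit : ∀ (n : ℕ) t, Γ (Φ^[n] t) = Γ t + n * ρ := by
    intro n t
    induction n with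
    | zero => simp
    | succ n ih => rw [Function.iterate_succ_apply', hs, ih]; push_cast; ring
  -- A monotone function with dense range has no jumps, and the range of Γ contains the dense set of
  -- all Γ 0 + nρ + m.
  refine ⟨Γ, Γ.monotone.continuous_of_denseRange ?_, Γ.monotone, Γ.map_add_one, hs⟩
  refine dense_of_exists_between fun x y hxy => ?_
  obtain ⟨n, -, m, h₁, h₂⟩ := exists_nat_int_mem_Ioo hρ 0 (sub_lt_sub_right hxy (Γ 0))
  refine ⟨_, ⟨Φ^[n] 0 + m, rfl⟩, ?_⟩
  rw [Γ.map_add_int, hit]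
  constructor <;> linarith

/-! ### The minimal set -/

/-- The set of points in no neighbourhood of which the monotone function `Γ` is constant. -/
def growthSet (Γ : ℝ → ℝ) : Set ℝ :=
  {t | ∀ a b, a < t → t < b → Γ a < Γ b}

/-- The set of right endpoints of the fibres of the monotone function `Γ`. -/
def rightEndpoints (Γ : ℝ → ℝ) : Set ℝ :=
  {t | ∀ x, t < x → Γ t < Γ x}

theorem isClosed_growthSet (Γ : ℝ → ℝ) : IsClosed (growthSet Γ) := by
  rw [← isOpen_compl_iff, isOpen_iff_mem_nhds]
  intro t ht
  simp only [growthSet, mem_compl_iff, mem_ofPred_eq, not_forall] at ht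
  obtain ⟨a, b, ha, hb, h⟩ := ht
  filter_upwards [Ioo_mem_nhds ha hb] with x hx hxK using h (hxK a b hx.1 hx.2)

section Semiconj

variable {Φ Γ : ℝ → ℝ} {ρ : ℝ}

theorem IsSemiconjLift.rightEndpoints_subset (hΓ : IsSemiconjLift Φ ρ Γ) :
    rightEndpoints Γ ⊆ growthSet Γ :=
  fun _ ht _ b ha hb => (hΓ.monotone ha.le).trans_lt (ht b hb)

/-- Fibres of Γ are nonempty, closed and bounded above, so each has a maximum. -/
theorem IsSemiconjLift.exists_mem_rightEndpoints (hΓ : IsSemiconjLift Φ ρ Γ) (s : ℝ) :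
    ∃ t ∈ rightEndpoints Γ, Γ t = s := by
  have hcl : IsClosed (Γ ⁻¹' {s}) := isClosed_singleton.preimage hΓ.continuous
  obtain ⟨t₂, ht₂⟩ := hΓ.surjective (s + 1)
  have hbdd : BddAbove (Γ ⁻¹' {s}) := by
    refine ⟨t₂, fun t (ht : Γ t = s) => (hΓ.monotone.reflect_lt ?_).le⟩
    rw [ht, ht₂]; linarith
  have hmem : Γ (sSup (Γ ⁻¹' {s})) = s := hcl.csSup_mem (hΓ.surjective s) hbdd
  refine ⟨_, fun x hx => lt_of_le_of_ne (hΓ.monotone hx.le) fun h => ?_, hmem⟩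
  exact absurd (le_csSup hbdd (show x ∈ Γ ⁻¹' {s} from h.symm.trans hmem)) (not_le.mpr hx)

theorem IsSemiconjLift.growthSet_add_int (hΓ : IsSemiconjLift Φ ρ Γ) {t : ℝ}
    (ht : t ∈ growthSet Γ) (m : ℤ) : t + m ∈ growthSet Γ := by
  intro a b ha hb
  have h := ht (a - m) (b - m) (by linarith) (by linarith)
  have ea := map_add_int_of_map_add_one hΓ.map_add_one (a - m) m
  have eb := map_add_int_of_map_add_one hΓ.map_add_one (b - m) m
  rw [sub_add_cancel] at ea eb
  linarith

theorem IsSemiconjLift.rightEndpoints_add_int (hΓ : IsSemiconjLift Φ ρ Γ) {t : ℝ}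
    (ht : t ∈ rightEndpoints Γ) (m : ℤ) : t + m ∈ rightEndpoints Γ := by
  intro x hx
  have h := ht (x - m) (by linarith)
  have ex := map_add_int_of_map_add_one hΓ.map_add_one (x - m) m
  rw [sub_add_cancel] at ex
  rw [map_add_int_of_map_add_one hΓ.map_add_one]
  linarith

theorem IsSemiconjLift.growthSet_map (hΓ : IsSemiconjLift Φ ρ Γ) (hΦ : IsCircleHomeoLift Φ) {t : ℝ}
    (ht : t ∈ growthSet Γ) : Φ t ∈ growthSet Γ := by
  intro a b ha hb
  obtain ⟨a, rfl⟩ := hΦ.surjective a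
  obtain ⟨b, rfl⟩ := hΦ.surjective b
  rw [hΓ.semiconj, hΓ.semiconj]
  have := ht a b (hΦ.strictMono.lt_iff_lt.mp ha) (hΦ.strictMono.lt_iff_lt.mp hb)
  linarith

theorem IsSemiconjLift.map_mem_rightEndpoints_iff (hΓ : IsSemiconjLift Φ ρ Γ)
    (hΦ : IsCircleHomeoLift Φ) {t : ℝ} : Φ t ∈ rightEndpoints Γ ↔ t ∈ rightEndpoints Γ := by
  constructor
  · intro ht x hx
    have := ht (Φ x) (hΦ.strictMono hx)
    rw [hΓ.semiconj, hΓ.semiconj] at this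
    linarith
  · intro ht x hx
    obtain ⟨x, rfl⟩ := hΦ.surjective x
    rw [hΓ.semiconj, hΓ.semiconj]
    have := ht x (hΦ.strictMono.lt_iff_lt.mp hx)
    linarith

/-- Every forward orbit, moved by integers, accumulates at every point of the growth set. -/
theorem IsSemiconjLift.exists_iterate_mem_Ioo (hΓ : IsSemiconjLift Φ ρ Γ) (hρ : Irrational ρ)
    {t a b : ℝ} (ht : t ∈ growthSet Γ) (ha : a < t) (hb : t < b) (c : ℝ) (N : ℕ) :
    ∃ n : ℕ, N ≤ n ∧ ∃ m : ℤ, Φ^[n] c + m ∈ Ioo a b := by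
  obtain ⟨n, hn, m, h₁, h₂⟩ :=
    exists_nat_int_mem_Ioo hρ N (sub_lt_sub_right (ht a b ha hb) (Γ c))
  refine ⟨n, hn, m, hΓ.monotone.reflect_lt ?_, hΓ.monotone.reflect_lt ?_⟩ <;>
  · rw [hΓ.map_iterate_add_int]
    linarith

theorem mapsTo_totalLift (hΦ : IsCircleHomeoLift Φ) {C : Set UnitAddCircle}
    (h : MapsTo (circleMap Φ) C C) : MapsTo Φ (totalLift C) (totalLift C) := by
  intro t ht
  have := h ht
  rwa [circleMap_coe hΦ.map_add_one] at this

theorem add_int_mem_totalLift {C : Set UnitAddCircle} {t : ℝ} (ht : t ∈ totalLift C) (m : ℤ) :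
    t + m ∈ totalLift C := by
  have : ((t + m : ℝ) : UnitAddCircle) = t := coe_eq_coe_iff_exists_int.mpr ⟨m, rfl⟩
  rwa [totalLift, mem_ofPred_eq, this]

theorem totalLift_image_coe {K : Set ℝ} (h : ∀ t ∈ K, ∀ m : ℤ, t + m ∈ K) :
    totalLift ((fun t : ℝ => (t : UnitAddCircle)) '' K) = K := by
  ext t
  constructor
  · rintro ⟨s, hs, hst⟩
    obtain ⟨m, rfl⟩ := coe_eq_coe_iff_exists_int.mp hst.symm
    exact h s hs m
  · exact fun ht => ⟨t, ht, rfl⟩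

theorem isClosed_totalLift {C : Set UnitAddCircle} : IsClosed (totalLift C) ↔ IsClosed C :=
  (QuotientAddGroup.isQuotientMap_mk (N := AddSubgroup.zmultiples (1 : ℝ))).isClosed_preimage

/-- The orbit of any point of C stays in C and accumulates at every point of the growth set, and C
is closed. This gives both minimality and uniqueness. -/
theorem IsSemiconjLift.growthSet_subset_totalLift (hΓ : IsSemiconjLift Φ ρ Γ) (hρ : Irrational ρ)
    (hΦ : IsCircleHomeoLift Φ) {C : Set UnitAddCircle} (hne : C.Nonempty) (hcl : IsClosed C)
    (hC : MapsTo (circleMap Φ) C C) : growthSet Γ ⊆ totalLift C := by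
  obtain ⟨z, hz⟩ := hne
  obtain ⟨c, rfl⟩ := QuotientAddGroup.mk_surjective z
  intro t ht
  rw [← (isClosed_totalLift.mpr hcl).closure_eq, mem_closure_iff_nhds]
  intro U hU
  obtain ⟨a, b, ⟨ha, hb⟩, hab⟩ := mem_nhds_iff_exists_Ioo_subset.mp hU
  obtain ⟨n, -, m, h⟩ := hΓ.exists_iterate_mem_Ioo hρ ht ha hb c 0
  exact ⟨_, hab h, add_int_mem_totalLift ((mapsTo_totalLift hΦ hC).iterate n hz) m⟩

theorem IsSemiconjLift.isMinimalSet_image_growthSet (hΓ : IsSemiconjLift Φ ρ Γ)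
    (hρ : Irrational ρ) (hΦ : IsCircleHomeoLift Φ) :
    IsMinimalSet (circleMap Φ) ((fun t : ℝ => (t : UnitAddCircle)) '' growthSet Γ) where
  nonempty := by
    obtain ⟨t, ht, -⟩ := hΓ.exists_mem_rightEndpoints 0
    exact ⟨_, t, hΓ.rightEndpoints_subset ht, rfl⟩
  isClosed := by
    rw [← isClosed_totalLift, totalLift_image_coe fun _ ht => hΓ.growthSet_add_int ht]
    exact isClosed_growthSet Γ
  mapsTo := by
    rintro _ ⟨t, ht, rfl⟩
    exact ⟨Φ t, hΓ.growthSet_map hΦ ht, (circleMap_coe hΦ.map_add_one t).symm⟩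
  minimal := by
    intro C hC hne hcl hmaps
    refine hC.antisymm ?_
    rintro _ ⟨t, ht, rfl⟩
    exact hΓ.growthSet_subset_totalLift hρ hΦ hne hcl hmaps ht

theorem IsSemiconjLift.isMinimalSet_iff (hΓ : IsSemiconjLift Φ ρ Γ) (hρ : Irrational ρ)
    (hΦ : IsCircleHomeoLift Φ) {Δ : Set UnitAddCircle} :
    IsMinimalSet (circleMap Φ) Δ ↔ Δ = (fun t : ℝ => (t : UnitAddCircle)) '' growthSet Γ := by
  have hK := hΓ.isMinimalSet_image_growthSet hρ hΦ
  refine ⟨fun h => (h.minimal _ ?_ hK.nonempty hK.isClosed hK.mapsTo).symm, fun h => h ▸ hK⟩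
  rintro _ ⟨t, ht, rfl⟩
  exact hΓ.growthSet_subset_totalLift hρ hΦ h.nonempty h.isClosed h.mapsTo ht

theorem IsSemiconjLift.totalLift_eq_growthSet (hΓ : IsSemiconjLift Φ ρ Γ) (hρ : Irrational ρ)
    (hΦ : IsCircleHomeoLift Φ) {Δ : Set UnitAddCircle} (h : IsMinimalSet (circleMap Φ) Δ) :
    totalLift Δ = growthSet Γ := by
  rw [(hΓ.isMinimalSet_iff hρ hΦ).mp h, totalLift_image_coe fun _ ht => hΓ.growthSet_add_int ht]

/-! ### Transitivity -/

theorem IsSemiconjLift.growthSet_eq_univ (hΓ : IsSemiconjLift Φ ρ Γ)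
    (h : Function.Injective Γ) : growthSet Γ = univ :=
  eq_univ_of_forall fun _ _ _ ha hb => hΓ.monotone.strictMono_of_injective h (ha.trans hb)

theorem IsSemiconjLift.isTransitive_of_injective (hΓ : IsSemiconjLift Φ ρ Γ) (hρ : Irrational ρ)
    (hΦ : IsCircleHomeoLift Φ) (h : Function.Injective Γ) : IsTransitive (circleMap Φ) := by
  refine ⟨((0 : ℝ) : UnitAddCircle), fun z => ?_⟩
  obtain ⟨t, rfl⟩ := QuotientAddGroup.mk_surjective z
  rw [mem_closure_iff_nhds]
  intro U hU
  have hcont : ContinuousAt (fun t : ℝ => (t : UnitAddCircle)) t :=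
    (AddCircle.continuous_mk' (1 : ℝ)).continuousAt
  obtain ⟨a, b, ⟨ha, hb⟩, hab⟩ := mem_nhds_iff_exists_Ioo_subset.mp (hcont hU)
  obtain ⟨n, -, m, hn⟩ := hΓ.exists_iterate_mem_Ioo hρ
    (hΓ.growthSet_eq_univ h ▸ mem_univ t) ha hb 0 0
  refine ⟨_, hab hn, n, ?_⟩
  dsimp only
  rw [circleMap_iterate_coe hΦ.map_add_one]
  exact (coe_eq_coe_iff_exists_int.mpr ⟨m, rfl⟩).symm

/-- If Γ were constant on [a, b], a dense orbit would visit both halves. Equal values of Γ at the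
two visits force equal times and equal integer shifts by irrationality, hence the same point in two
disjoint halves. -/
theorem IsSemiconjLift.injective_of_isTransitive (hΓ : IsSemiconjLift Φ ρ Γ) (hρ : Irrational ρ)
    (hΦ : IsCircleHomeoLift Φ) (h : IsTransitive (circleMap Φ)) : Function.Injective Γ := by
  obtain ⟨z, hz⟩ := h
  obtain ⟨c, rfl⟩ := QuotientAddGroup.mk_surjective z
  have key : ∀ a b : ℝ, a < b → ∃ (n : ℕ) (m : ℤ), Φ^[n] c + m ∈ Ioo a b := by
    intro a b hab
    have hopen : IsOpen ((fun t : ℝ => (t : UnitAddCircle)) '' Ioo a b) :=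
      QuotientAddGroup.isOpenMap_coe _ isOpen_Ioo
    obtain ⟨_, ⟨t, ht, rfl⟩, n, hn⟩ := hz.inter_open_nonempty _ hopen
      ((nonempty_Ioo.mpr hab).image _)
    have hn' : (t : UnitAddCircle) = (Φ^[n] c : ℝ) :=
      hn.symm.trans (circleMap_iterate_coe hΦ.map_add_one n c)
    obtain ⟨m, rfl⟩ := coe_eq_coe_iff_exists_int.mp hn'
    exact ⟨n, m, ht⟩
  have hlt : ∀ a b : ℝ, a < b → Γ a ≠ Γ b := by
    intro a b hab heq
    obtain ⟨n, m, h₁, h₂⟩ := key a ((a + b) / 2) (by linarith)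
    obtain ⟨n', m', h₁', h₂'⟩ := key ((a + b) / 2) b (by linarith)
    have hval : ∀ x, a < x → x < b → Γ x = Γ a := fun x ha hb =>
      le_antisymm (heq ▸ hΓ.monotone hb.le) (hΓ.monotone ha.le)
    have e := (hval _ h₁ (by linarith)).trans (hval _ (by linarith) h₂').symm
    rw [hΓ.map_iterate_add_int, hΓ.map_iterate_add_int] at e
    obtain ⟨hn, hm⟩ := eq_of_mul_add_eq hρ (n := n) (n' := n') (m := m) (m' := m')
      (by push_cast; linarith)
    obtain rfl : n = n' := by exact_mod_cast hn
    subst hm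
    linarith
  intro a b hab
  rcases lt_trichotomy a b with h | h | h
  · exact absurd hab (hlt a b h)
  · exact h
  · exact absurd hab.symm (hlt b a h)

/-! ### Displacement and interspike intervals -/

theorem isi_add_one (Φ : ℝ → ℝ) (n : ℕ) (t : ℝ) :
    isi Φ (n + 1) t = displacement Φ (Φ^[n] t) := by
  rw [isi, displacement, Function.iterate_succ_apply', Nat.add_sub_cancel]

theorem displacement_iterate_mem_isiValues (Φ : ℝ → ℝ) (n : ℕ) (t : ℝ) :
    displacement Φ (Φ^[n] t) ∈ isiValues Φ t :=
  ⟨n + 1, by omega, (isi_add_one Φ n t).symm⟩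

theorem isiValues_subset {S : Set ℝ} (hS : MapsTo Φ S S) {t : ℝ} (ht : t ∈ S) :
    isiValues Φ t ⊆ displacement Φ '' S := by
  rintro _ ⟨n, hn, rfl⟩
  obtain ⟨n, rfl⟩ := Nat.exists_eq_add_of_le' hn
  rw [isi_add_one]
  exact ⟨_, hS.iterate n ht, rfl⟩

theorem IsCircleHomeoLift.displacement_add_int (hΦ : IsCircleHomeoLift Φ) (t : ℝ) (m : ℤ) :
    displacement Φ (t + m) = displacement Φ t := by
  rw [displacement, displacement, map_add_int_of_map_add_one hΦ.map_add_one]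
  ring

theorem IsCircleHomeoLift.isi_add_int (hΦ : IsCircleHomeoLift Φ) (l : ℕ) (t : ℝ) (m : ℤ) :
    isi Φ l (t + m) = isi Φ l t := by
  rw [isi, isi, map_add_int_of_map_add_one (iterate_add_one hΦ.map_add_one l),
    map_add_int_of_map_add_one (iterate_add_one hΦ.map_add_one (l - 1))]
  ring

theorem IsCircleHomeoLift.continuous_displacement (hΦ : IsCircleHomeoLift Φ) :
    Continuous (displacement Φ) :=
  hΦ.continuous.sub continuous_id

theorem IsCircleHomeoLift.continuous_isi (hΦ : IsCircleHomeoLift Φ) (l : ℕ) :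
    Continuous (isi Φ l) :=
  (hΦ.continuous.iterate l).sub (hΦ.continuous.iterate (l - 1))

theorem exists_int_add_mem_Icc (t : ℝ) : ∃ m : ℤ, t + m ∈ Icc (0 : ℝ) 1 :=
  ⟨-⌊t⌋, by push_cast; linarith [Int.floor_le t], by push_cast; linarith [Int.lt_floor_add_one t]⟩

theorem IsCircleHomeoLift.displacement_image_unitLift (hΦ : IsCircleHomeoLift Φ)
    (D : Set UnitAddCircle) :
    displacement Φ '' unitLift D = displacement Φ '' totalLift D := by
  refine (image_mono inter_subset_left).antisymm ?_
  rintro _ ⟨t, ht, rfl⟩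
  obtain ⟨m, hm⟩ := exists_int_add_mem_Icc t
  exact ⟨t + m, ⟨add_int_mem_totalLift ht m, hm⟩, hΦ.displacement_add_int t m⟩

theorem IsCircleHomeoLift.displacement_image_Icc (hΦ : IsCircleHomeoLift Φ) :
    displacement Φ '' Icc 0 1 = displacement Φ '' univ := by
  refine (image_mono (subset_univ _)).antisymm ?_
  rintro _ ⟨t, -, rfl⟩
  obtain ⟨m, hm⟩ := exists_int_add_mem_Icc t
  exact ⟨t + m, hm, hΦ.displacement_add_int t m⟩

/-- The starting point c need not lie in the growth set: its orbit accumulates there in any case,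
and the periodic displacement ignores the integer shifts. -/
theorem IsSemiconjLift.displacement_image_growthSet_subset (hΓ : IsSemiconjLift Φ ρ Γ)
    (hρ : Irrational ρ) (hΦ : IsCircleHomeoLift Φ) (c : ℝ) :
    displacement Φ '' growthSet Γ ⊆ closure (range fun n : ℕ => displacement Φ (Φ^[n] c)) := by
  rintro _ ⟨t, ht, rfl⟩
  rw [mem_closure_iff_nhds]
  intro U hU
  obtain ⟨a, b, ⟨ha, hb⟩, hab⟩ :=
    mem_nhds_iff_exists_Ioo_subset.mp (hΦ.continuous_displacement.continuousAt hU)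
  obtain ⟨n, -, m, hn⟩ := hΓ.exists_iterate_mem_Ioo hρ ht ha hb c 0
  refine ⟨_, hab hn, n, ?_⟩
  exact (hΦ.displacement_add_int _ m).symm

theorem IsSemiconjLift.denseSubset_isiValues (hΓ : IsSemiconjLift Φ ρ Γ)
    (hρ : Irrational ρ) (hΦ : IsCircleHomeoLift Φ) {t : ℝ} (ht : t ∈ growthSet Γ) :
    DenseSubset (isiValues Φ t) (displacement Φ '' growthSet Γ) := by
  refine ⟨isiValues_subset (fun _ => hΓ.growthSet_map hΦ) ht,
    (hΓ.displacement_image_growthSet_subset hρ hΦ t).trans (closure_mono ?_)⟩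
  rintro _ ⟨n, rfl⟩
  exact displacement_iterate_mem_isiValues Φ n t

theorem IsSemiconjLift.exists_strictMono_tendsto_isi (hΓ : IsSemiconjLift Φ ρ Γ)
    (hρ : Irrational ρ) (hΦ : IsCircleHomeoLift Φ) (t₀ : ℝ) {t : ℝ} (ht : t ∈ growthSet Γ) :
    ∃ n : ℕ → ℕ, StrictMono n ∧ ∀ l : ℕ,
      Tendsto (fun k : ℕ => isi Φ l (Φ^[n k] t₀)) atTop (𝓝 (isi Φ l t)) := by
  -- Approximations exist at arbitrarily late times, which lets the extracted times be strictly
  -- increasing; one sequence serves all l because each `isi Φ l` is continuous and 1-periodic.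
  have hfreq : ∀ k : ℕ, ∃ᶠ n : ℕ in atTop, ∃ m : ℤ, |Φ^[n] t₀ + m - t| < 1 / ((k : ℝ) + 1) := by
    intro k
    rw [frequently_atTop]
    intro N
    have hk : 0 < 1 / ((k : ℝ) + 1) := by positivity
    obtain ⟨n, hn, m, h₁, h₂⟩ := hΓ.exists_iterate_mem_Ioo hρ ht
      (sub_lt_self t hk) (lt_add_of_pos_right t hk) t₀ N
    exact ⟨n, hn, m, abs_lt.mpr ⟨by linarith, by linarith⟩⟩
  obtain ⟨n, hn, h⟩ := extraction_forall_of_frequently hfreq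
  choose m hm using h
  refine ⟨n, hn, fun l => ?_⟩
  have hlim : Tendsto (fun k => Φ^[n k] t₀ + m k) atTop (𝓝 t) := by
    rw [tendsto_iff_norm_sub_tendsto_zero]
    exact squeeze_zero (fun _ => norm_nonneg _) (fun k => (hm k).le)
      tendsto_one_div_add_atTop_nhds_zero_nat
  refine (((hΦ.continuous_isi l).tendsto t).comp hlim).congr fun k => ?_
  exact hΦ.isi_add_int l _ (m k)

/-! ### The inverse of the semi-conjugacy -/

/-- Since Γ t + ρ = Γ (Φ t) and Φ t stays in D, the partial inverse returns exactly Φ t and t. -/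
theorem IsSemiconjLift.omegaOn_map (hΓ : IsSemiconjLift Φ ρ Γ) {D : Set ℝ} (hD : MapsTo Φ D D)
    (hinj : InjOn Γ D) {t : ℝ} (ht : t ∈ D) : omegaOn Γ ρ D (Γ t) = displacement Φ t := by
  rw [omegaOn, displacement, ← hΓ.semiconj, hinj.leftInvOn_invFunOn ht,
    hinj.leftInvOn_invFunOn (hD ht)]

theorem IsSemiconjLift.omegaOn_image_Icc (hΓ : IsSemiconjLift Φ ρ Γ) (hΦ : IsCircleHomeoLift Φ)
    (hinj : Function.Injective Γ) :
    displacement Φ '' Icc 0 1 = omegaOn Γ ρ univ '' Icc 0 1 := by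
  have hω : ∀ t, omegaOn Γ ρ univ (Γ t) = displacement Φ t := fun t =>
    hΓ.omegaOn_map (mapsTo_univ _ _) hinj.injOn (mem_univ t)
  rw [hΦ.displacement_image_Icc]
  ext y
  constructor
  · rintro ⟨t, -, rfl⟩
    obtain ⟨m, hm⟩ := exists_int_add_mem_Icc (Γ t)
    refine ⟨_, hm, ?_⟩
    rw [← map_add_int_of_map_add_one hΓ.map_add_one, hω, hΦ.displacement_add_int]
  · rintro ⟨s, -, rfl⟩
    obtain ⟨t, rfl⟩ := hΓ.surjective s
    exact ⟨t, mem_univ t, (hω t).symm⟩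

theorem IsSemiconjLift.injOn_totalLift (hΓ : IsSemiconjLift Φ ρ Γ) {D : Set UnitAddCircle}
    (h : InjOn (circleMap Γ) D) : InjOn Γ (totalLift D) := by
  intro s hs t ht hst
  have e : (s : UnitAddCircle) = t := h hs ht (by
    rw [circleMap_coe hΓ.map_add_one, circleMap_coe hΓ.map_add_one, hst])
  obtain ⟨m, rfl⟩ := coe_eq_coe_iff_exists_int.mp e
  rw [map_add_int_of_map_add_one hΓ.map_add_one] at hst
  simpa using hst

theorem IsSemiconjLift.surjOn_totalLift (hΓ : IsSemiconjLift Φ ρ Γ) {D : Set UnitAddCircle}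
    (h : SurjOn (circleMap Γ) D univ) : SurjOn Γ (totalLift D) univ := by
  intro s _
  obtain ⟨z, hz, hzs⟩ := h (mem_univ (s : UnitAddCircle))
  obtain ⟨t, rfl⟩ := QuotientAddGroup.mk_surjective z
  have hzs' : (s : UnitAddCircle) = (Γ t : ℝ) := hzs.symm.trans (circleMap_coe hΓ.map_add_one t)
  obtain ⟨m, rfl⟩ := coe_eq_coe_iff_exists_int.mp hzs'
  exact ⟨t + m, add_int_mem_totalLift hz m, map_add_int_of_map_add_one hΓ.map_add_one t m⟩

theorem IsSemiconjLift.omegaOn_image (hΓ : IsSemiconjLift Φ ρ Γ) (hΦ : IsCircleHomeoLift Φ)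
    {D : Set UnitAddCircle} (hD : MapsTo (circleMap Φ) D D) (hinj : InjOn (circleMap Γ) D) :
    omegaOn Γ ρ (totalLift D) '' (Γ '' unitLift D) = displacement Φ '' unitLift D := by
  rw [image_image]
  exact image_congr fun t ht =>
    hΓ.omegaOn_map (mapsTo_totalLift hΦ hD) (hΓ.injOn_totalLift hinj) ht.1

theorem IsSemiconjLift.denseSubset_displacement_totalLift (hΓ : IsSemiconjLift Φ ρ Γ)
    (hρ : Irrational ρ) (hΦ : IsCircleHomeoLift Φ) {D : Set UnitAddCircle} (hne : D.Nonempty)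
    (hD : MapsTo (circleMap Φ) D D) (hDK : totalLift D ⊆ growthSet Γ) :
    DenseSubset (displacement Φ '' totalLift D) (displacement Φ '' growthSet Γ) := by
  obtain ⟨z, hz⟩ := hne
  obtain ⟨c, rfl⟩ := QuotientAddGroup.mk_surjective z
  refine ⟨image_mono hDK,
    (hΓ.displacement_image_growthSet_subset hρ hΦ c).trans (closure_mono ?_)⟩
  rintro _ ⟨n, rfl⟩
  exact ⟨_, (mapsTo_totalLift hΦ hD).iterate n hz, rfl⟩

/-- Only countably many points of the growth set share their value with another point. -/
theorem countable_growthSet_diff {D : Set ℝ} (hD : SurjOn Γ D univ) :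
    (growthSet Γ \ D).Countable := by
  -- A point t outside D shares its value with some u in D. Γ is constant between them, so no growth
  -- point lies strictly between and t is isolated in the growth set on the side of u.
  refine ((countable_setOfPred_isolated_right_within (s := growthSet Γ)).union
    (countable_setOfPred_isolated_left_within (s := growthSet Γ))).mono ?_
  rintro t ⟨ht, htD⟩
  obtain ⟨u, hu, hut⟩ := hD (mem_univ (Γ t))
  have hcst : ∀ a b x : ℝ, Γ a = Γ b → a < x → x < b → x ∉ growthSet Γ := fun a b x h ha hb hx =>
    (hx a b ha hb).ne h
  rcases lt_trichotomy t u with h | rfl | h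
  · left
    refine ⟨ht, empty_mem_iff_bot.mp (mem_nhdsWithin_iff_exists_mem_nhds_inter.mpr
      ⟨Iio u, Iio_mem_nhds h, ?_⟩)⟩
    rintro x ⟨hxu, hxK, htx⟩
    exact hcst t u x hut.symm htx hxu hxK
  · exact absurd hu htD
  · right
    refine ⟨ht, empty_mem_iff_bot.mp (mem_nhdsWithin_iff_exists_mem_nhds_inter.mpr
      ⟨Ioi u, Ioi_mem_nhds h, ?_⟩)⟩
    rintro x ⟨hxu, hxK, htx⟩
    exact hcst u t x hut hxu htx hxK

/-- Right endpoints select one point from each fibre of Γ; Φ permutes the fibres and preserves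
order, so it permutes these endpoints. -/
theorem IsSemiconjLift.exists_invariant_bijOn (hΓ : IsSemiconjLift Φ ρ Γ)
    (hΦ : IsCircleHomeoLift Φ) :
    ∃ D ⊆ (fun t : ℝ => (t : UnitAddCircle)) '' growthSet Γ,
      circleMap Φ '' D = D ∧ BijOn (circleMap Γ) D univ := by
  refine ⟨(fun t : ℝ => (t : UnitAddCircle)) '' rightEndpoints Γ,
    image_mono hΓ.rightEndpoints_subset, ?_, mapsTo_univ _ _, ?_, ?_⟩
  · ext z
    constructor
    · rintro ⟨_, ⟨t, ht, rfl⟩, rfl⟩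
      exact ⟨Φ t, (hΓ.map_mem_rightEndpoints_iff hΦ).mpr ht,
        (circleMap_coe hΦ.map_add_one t).symm⟩
    · rintro ⟨t, ht, rfl⟩
      obtain ⟨t, rfl⟩ := hΦ.surjective t
      exact ⟨_, ⟨t, (hΓ.map_mem_rightEndpoints_iff hΦ).mp ht, rfl⟩, circleMap_coe hΦ.map_add_one t⟩
  · rintro _ ⟨s, hs, rfl⟩ _ ⟨t, ht, rfl⟩ hst
    dsimp only at hst ⊢
    rw [circleMap_coe hΓ.map_add_one, circleMap_coe hΓ.map_add_one] at hst
    obtain ⟨m, hm⟩ := coe_eq_coe_iff_exists_int.mp hst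
    rw [← map_add_int_of_map_add_one hΓ.map_add_one] at hm
    refine coe_eq_coe_iff_exists_int.mpr ⟨m, ?_⟩
    rcases lt_trichotomy s (t + m) with h | h | h
    · exact absurd hm (hs _ h).ne
    · exact h
    · exact absurd hm.symm (hΓ.rightEndpoints_add_int ht m _ h).ne
  · intro z _
    obtain ⟨s, rfl⟩ := QuotientAddGroup.mk_surjective z
    obtain ⟨t, ht, rfl⟩ := hΓ.exists_mem_rightEndpoints s
    exact ⟨_, ⟨t, ht, rfl⟩, circleMap_coe hΓ.map_add_one t⟩

end Semiconj


/-! ### Denjoy's theorem -/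

/-- Intervals whose integer translates are pairwise disjoint have bounded total length. -/
theorem sum_length_le_two {ι : Type*} (s : Finset ι) (u v : ι → ℝ) (huv : ∀ i ∈ s, u i ≤ v i)
    (hd : ∀ i ∈ s, ∀ j ∈ s, ∀ k : ℤ, ∀ x, x ∈ Icc (u i) (v i) → x - k ∈ Icc (u j) (v j) →
      i = j ∧ k = 0) : ∑ i ∈ s, (v i - u i) ≤ 2 := by
  have hlt : ∀ i ∈ s, v i < u i + 1 := by
    intro i hi
    by_contra! h
    have := (hd i hi i hi 1 (u i + 1) ⟨by linarith, h⟩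
      ⟨by push_cast; linarith, by push_cast; linarith [huv i hi]⟩).2
    omega
  -- Each interval is shorter than 1; moved so as to begin in [0, 1), it lies in [0, 2], and
  -- disjointness is kept.
  set J : ι → Set ℝ := fun i => Icc (u i - ⌊u i⌋) (v i - ⌊u i⌋) with hJ
  have hdisj : (s : Set ι).PairwiseDisjoint J := by
    intro i hi j hj hij
    rw [Function.onFun, Set.disjoint_left]
    rintro x ⟨h₁, h₂⟩ ⟨h₃, h₄⟩
    refine hij (hd i hi j hj (⌊u i⌋ - ⌊u j⌋) (x + ⌊u i⌋) ⟨by linarith, by linarith⟩ ⟨?_, ?_⟩).1 <;>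
    · push_cast; linarith
  have hsub : (⋃ i ∈ s, J i) ⊆ Icc 0 2 := by
    refine iUnion₂_subset fun i hi => Icc_subset_Icc ?_ ?_
    · linarith [Int.floor_le (u i)]
    · linarith [hlt i hi, Int.lt_floor_add_one (u i)]
  have hvol := measure_mono (μ := volume) hsub
  rw [measure_biUnion_finset hdisj fun i _ => measurableSet_Icc] at hvol
  simp only [hJ, Real.volume_Icc, sub_sub_sub_cancel_right] at hvol
  rw [← ENNReal.ofReal_sum_of_nonneg fun i hi => sub_nonneg.mpr (huv i hi),
    ENNReal.ofReal_le_ofReal_iff (by norm_num)] at hvol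
  linarith

section Denjoy

variable {Φ Γ : ℝ → ℝ} {ρ : ℝ}

theorem IsCircleHomeoLift.exists_orbit (hΦ : IsCircleHomeoLift Φ) (a : ℝ) :
    ∃ A : ℤ → ℝ, A 0 = a ∧ ∀ i, A (i + 1) = Φ (A i) := by
  let e : Equiv.Perm ℝ := Equiv.ofBijective Φ ⟨hΦ.strictMono.injective, hΦ.surjective⟩
  refine ⟨fun i => (e ^ i) a, by simp, fun i => ?_⟩
  dsimp only
  rw [add_comm, zpow_one_add]
  rfl

theorem IsSemiconjLift.map_orbit (hΓ : IsSemiconjLift Φ ρ Γ) {A : ℤ → ℝ}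
    (hA : ∀ i, A (i + 1) = Φ (A i)) (i : ℤ) : Γ (A i) = Γ (A 0) + i * ρ := by
  induction i using Int.induction_on with
  | zero => simp
  | succ i ih => rw [hA, hΓ.semiconj, ih]; push_cast; ring
  | pred i ih =>
    have h := hA (-(i : ℤ) - 1)
    rw [sub_add_cancel] at h
    rw [h, hΓ.semiconj] at ih
    push_cast at ih ⊢
    linarith

theorem IsCircleHomeoLift.orbit_lt_orbit (hΦ : IsCircleHomeoLift Φ) {A B : ℤ → ℝ}
    (hA : ∀ i, A (i + 1) = Φ (A i)) (hB : ∀ i, B (i + 1) = Φ (B i)) (h : A 0 < B 0) (i : ℤ) :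
    A i < B i := by
  induction i using Int.induction_on with
  | zero => exact h
  | succ i ih => rw [hA, hB]; exact hΦ.strictMono ih
  | pred i ih =>
    have hA' := hA (-(i : ℤ) - 1)
    have hB' := hB (-(i : ℤ) - 1)
    rw [sub_add_cancel] at hA' hB'
    rw [hA', hB'] at ih
    exact hΦ.strictMono.lt_iff_lt.mp ih

/-- At a closest return time `n`, the hulls of the wandering intervals `[A i, B i]` and
`[A (i - n), B (i - n)] + m`, over `n` consecutive indices `i`, have bounded total length. -/
theorem IsSemiconjLift.sum_hull_le_two (hΓ : IsSemiconjLift Φ ρ Γ) {A B : ℤ → ℝ}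
    (hA : ∀ i, A (i + 1) = Φ (A i)) (hB : ∀ i, B (i + 1) = Φ (B i)) (hAB : ∀ i, A i < B i)
    (h0 : Γ (A 0) = Γ (B 0)) {n : ℕ} {m : ℤ} (hδ : |n * ρ - m| < 1)
    (hn : ∀ i : ℕ, 0 < i → i < n → ∀ k : ℤ, |n * ρ - m| < |i * ρ - k|) (r : ℤ) :
    ∑ i ∈ Finset.range n, (max (B (i + r)) (B (i + r - n) + m) -
      min (A (i + r)) (A (i + r - n) + m)) ≤ 2 := by
  have hΓA := hΓ.map_orbit hA
  have hΓB := hΓ.map_orbit hB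
  -- On the i-th hull, Γ stays between Γ (A 0) + iρ and that value plus m - nρ. If hulls i and j
  -- meet after a shift by k, then |(i - j)ρ - k| ≤ |nρ - m|, which the closest return property
  -- forbids for i ≠ j, while |nρ - m| < 1 gives k = 0 for i = j.
  have hrange : ∀ (i : ℤ) (x : ℝ), x ∈ Icc (min (A i) (A (i - n) + m)) (max (B i) (B (i - n) + m)) →
      min 0 (m - n * ρ) ≤ Γ x - Γ (A 0) - i * ρ ∧ Γ x - Γ (A 0) - i * ρ ≤ max 0 (m - n * ρ) := by
    rintro i x ⟨h₁, h₂⟩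
    have h₁' := hΓ.monotone h₁
    have h₂' := hΓ.monotone h₂
    rw [hΓ.monotone.map_min, map_add_int_of_map_add_one hΓ.map_add_one, hΓA, hΓA (i - n)] at h₁'
    rw [hΓ.monotone.map_max, map_add_int_of_map_add_one hΓ.map_add_one, hΓB, hΓB (i - n),
      ← h0] at h₂'
    push_cast at h₁' h₂'
    rw [min_le_iff, le_max_iff] at *
    constructor
    · rcases h₁' with h | h
      · left; linarith
      · right; linarith
    · rcases h₂' with h | h
      · left; linarith
      · right; linarith
  refine sum_length_le_two _ (fun i : ℕ => min (A (i + r)) (A (i + r - n) + m))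
    (fun i : ℕ => max (B (i + r)) (B (i + r - n) + m))
    (fun i _ => (min_le_left _ _).trans ((hAB _).le.trans (le_max_left _ _))) ?_
  intro i hi j hj k x hxi hxj
  have hi' := hrange _ _ hxi
  have hj' := hrange _ _ hxj
  rw [sub_eq_add_neg x, ← Int.cast_neg, map_add_int_of_map_add_one hΓ.map_add_one] at hj'
  have hle : |((i : ℝ) - j) * ρ - k| ≤ |n * ρ - m| := by
    push_cast at hi' hj'
    rw [← neg_sub (m : ℝ), abs_neg]
    rcases le_total (m - n * ρ) 0 with h | h
    · rw [min_eq_right h, max_eq_left h] at hi' hj'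
      rw [abs_of_nonpos h, abs_le]
      constructor <;> linarith
    · rw [min_eq_left h, max_eq_right h] at hi' hj'
      rw [abs_of_nonneg h, abs_le]
      constructor <;> linarith
  rw [Finset.mem_range] at hi hj
  rcases lt_trichotomy i j with h | rfl | h
  · have := hn (j - i) (by omega) (by omega) (-k)
    rw [Nat.cast_sub h.le, ← abs_neg (((j : ℝ) - i) * ρ - _),
      show -(((j : ℝ) - i) * ρ - (-k : ℤ)) = (i - j) * ρ - k by push_cast; ring] at this
    exact absurd hle (not_le.mpr this)
  · refine ⟨rfl, ?_⟩
    rw [sub_self, zero_mul, zero_sub, abs_neg] at hle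
    have : |(k : ℝ)| < 1 := hle.trans_lt hδ
    rw [← Int.cast_abs] at this
    exact Int.abs_lt_one_iff.mp (by exact_mod_cast this)
  · have := hn (i - j) (by omega) (by omega) k
    rw [Nat.cast_sub h.le] at this
    exact absurd hle (not_le.mpr this)

/-- Γ is constant on each [A i, B i], with values that are distinct modulo 1, so these intervals are
disjoint modulo 1. Their lengths are summable over ℤ and tend to 0 in both time directions. -/
theorem IsSemiconjLift.exists_forall_length_lt (hΓ : IsSemiconjLift Φ ρ Γ) (hρ : Irrational ρ)
    {A B : ℤ → ℝ} (hA : ∀ i, A (i + 1) = Φ (A i)) (hB : ∀ i, B (i + 1) = Φ (B i))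
    (hAB : ∀ i, A i < B i) (h0 : Γ (A 0) = Γ (B 0)) {ε : ℝ} (hε : 0 < ε) :
    ∃ N : ℕ, ∀ n : ℕ, N ≤ n → B n - A n < ε ∧ B (-n) - A (-n) < ε := by
  have hval : ∀ (i : ℤ) (x : ℝ), x ∈ Icc (A i) (B i) → Γ x = Γ (A 0) + i * ρ := by
    intro i x hx
    refine le_antisymm ?_ ?_
    · rw [h0, ← hΓ.map_orbit hB]; exact hΓ.monotone hx.2
    · rw [← hΓ.map_orbit hA]; exact hΓ.monotone hx.1
  have hsum : Summable fun i => B i - A i := by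
    refine summable_of_sum_le (c := 2) (fun i => sub_nonneg.mpr (hAB i).le) fun s => ?_
    refine sum_length_le_two s A B (fun i _ => (hAB i).le) fun i _ j _ k x hxi hxj => ?_
    have h₁ := hval i x hxi
    have h₂ := hval j _ hxj
    rw [sub_eq_add_neg, ← Int.cast_neg, map_add_int_of_map_add_one hΓ.map_add_one, h₁] at h₂
    obtain ⟨h, h'⟩ := eq_of_mul_add_eq hρ (n := i) (m := -k) (n' := j) (m' := 0)
      (by push_cast at h₂ ⊢; linarith)
    exact ⟨h, by omega⟩
  have hlim := hsum.tendsto_cofinite_zero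
  have h₁ : Tendsto (fun n : ℕ => (n : ℤ)) atTop cofinite :=
    Nat.cofinite_eq_atTop ▸ (Nat.cast_injective (R := ℤ)).tendsto_cofinite
  have h₂ : Tendsto (fun n : ℕ => -(n : ℤ)) atTop cofinite :=
    Nat.cofinite_eq_atTop ▸ (neg_injective.comp (Nat.cast_injective (R := ℤ))).tendsto_cofinite
  exact eventually_atTop.mp (((hlim.comp h₁).eventually_lt_const hε).and
    ((hlim.comp h₂).eventually_lt_const hε))

/-- **Denjoy's theorem**: a circle homeomorphism with irrational rotation number has no wandering
intervals if its difference quotients are, in the logarithmic scale, of the form `p ξ - q ζ` with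
Lipschitz functions `p` and `q`. -/
theorem IsSemiconjLift.injective_of_lipschitz (hΓ : IsSemiconjLift Φ ρ Γ) (hρ : Irrational ρ)
    (hΦ : IsCircleHomeoLift Φ) {p q : ℝ → ℝ} {κ L : ℝ} (hL : 0 ≤ L)
    (hp : ∀ x y, |p x - p y| ≤ L * |x - y|) (hq : ∀ x y, |q x - q y| ≤ L * |x - y|)
    (hp₁ : ∀ t, p (t + 1) = p t + κ) (hq₁ : ∀ t, q (t + 1) = q t + κ)
    (hdist : ∀ a b, a < b → ∃ ξ ∈ Icc a b, ∃ ζ ∈ Icc (Φ a) (Φ b),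
      Real.log (Φ b - Φ a) - Real.log (b - a) = p ξ - q ζ) : Function.Injective Γ := by
  have hlt : ∀ a b : ℝ, a < b → Γ a ≠ Γ b := by
    intro a b hab heq
    obtain ⟨A, hA0, hA⟩ := hΦ.exists_orbit a
    obtain ⟨B, hB0, hB⟩ := hΦ.exists_orbit b
    have h0 : Γ (A 0) = Γ (B 0) := by rw [hA0, hB0, heq]
    have hAB := hΦ.orbit_lt_orbit hA hB (by rwa [hA0, hB0])
    set ℓ : ℤ → ℝ := fun i => Real.log (B i - A i) with hℓ
    have hstep : ∀ i, ∃ ξ ∈ Icc (A i) (B i), ∃ ζ ∈ Icc (A (i + 1)) (B (i + 1)),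
        ℓ (i + 1) - ℓ i = p ξ - q ζ := by
      intro i
      simp only [hℓ, hA, hB]
      exact hdist _ _ (hAB i)
    choose ξ hξ ζ hζ hpq using hstep
    -- The threshold makes ℓ n + ℓ (-n) - 2 ℓ 0 < -4L, whereas the distortion estimate bounds this
    -- quantity below by -4L: two Lipschitz terms, each with total hull length at most 2.
    obtain ⟨N, hN⟩ := hΓ.exists_forall_length_lt hρ hA hB hAB h0
      (Real.exp_pos (ℓ 0 - 2 * L))
    obtain ⟨n, hNn, m, hδ, hclose⟩ := exists_closest_return hρ N
    obtain ⟨hn₁, hn₂⟩ := hN n hNn.le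
    have hlog₁ : ℓ n < ℓ 0 - 2 * L := (Real.log_lt_iff_lt_exp (sub_pos.mpr (hAB _))).mpr hn₁
    have hlog₂ : ℓ (-n) < ℓ 0 - 2 * L := (Real.log_lt_iff_lt_exp (sub_pos.mpr (hAB _))).mpr hn₂
    set W : ℤ → ℝ := fun i => max (B i) (B (i - n) + m) - min (A i) (A (i - n) + m) with hW
    have hnear : ∀ (i : ℤ) (x y : ℝ), x ∈ Icc (A i) (B i) → y ∈ Icc (A (i - n)) (B (i - n)) →
        |x - (y + m)| ≤ W i := by
      rintro i x y ⟨hx₁, hx₂⟩ ⟨hy₁, hy₂⟩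
      have h₁ := min_le_left (A i) (A (i - n) + m)
      have h₂ := min_le_right (A i) (A (i - n) + m)
      have h₃ := le_max_left (B i) (B (i - n) + m)
      have h₄ := le_max_right (B i) (B (i - n) + m)
      rw [abs_le]
      constructor <;> simp only [hW] <;> linarith
    -- Times i and i - n are compared after a shift by m. The shift adds mκ to both p and q, so
    -- these contributions cancel.
    have hterm : ∀ i : ℕ, -(L * W i + L * W (i + 1)) ≤
        (ℓ (i + 1) - ℓ i) - (ℓ (i - n + 1) - ℓ (i - n)) := by
      intro i
      rw [hpq, hpq]
      have h₁ := (hp (ξ i) (ξ (i - n) + m)).trans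
        (mul_le_mul_of_nonneg_left (hnear i _ _ (hξ i) (hξ (i - n))) hL)
      have h₂ := (hq (ζ i) (ζ (i - n) + m)).trans
        (mul_le_mul_of_nonneg_left (hnear (i + 1) _ _ (hζ i)
          (by rw [show (i : ℤ) + 1 - n = i - n + 1 by ring]; exact hζ (i - n))) hL)
      rw [map_add_int_of_map_add_one_const hp₁] at h₁
      rw [map_add_int_of_map_add_one_const hq₁] at h₂
      have := (abs_le.mp h₁).1
      have := (abs_le.mp h₂).2
      linarith
    have hsum := Finset.sum_le_sum fun i (_ : i ∈ Finset.range n) => hterm i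
    rw [Finset.sum_neg_distrib, Finset.sum_add_distrib,
      ← Finset.mul_sum (Finset.range n) (fun i : ℕ => W i) L,
      ← Finset.mul_sum (Finset.range n) (fun i : ℕ => W (i + 1)) L,
      Finset.sum_sub_distrib (fun i : ℕ => ℓ (i + 1) - ℓ i)] at hsum
    have t₁ : ∑ i ∈ Finset.range n, (ℓ (i + 1) - ℓ i) = ℓ n - ℓ 0 := by
      simpa using Finset.sum_range_sub (fun i : ℕ => ℓ i) n
    have t₂ : ∑ i ∈ Finset.range n, (ℓ (i - n + 1) - ℓ (i - n)) = ℓ 0 - ℓ (-n) := by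
      have := Finset.sum_range_sub (fun i : ℕ => ℓ (i - n)) n
      simp only [Nat.cast_add, Nat.cast_one, sub_self, Nat.cast_zero, zero_sub] at this
      rw [← this]
      refine Finset.sum_congr rfl fun i _ => ?_
      rw [sub_add_eq_add_sub]
    have w₁ : ∑ i ∈ Finset.range n, W i ≤ 2 := by
      simpa only [add_zero] using hΓ.sum_hull_le_two hA hB hAB h0 hδ hclose 0
    have w₂ : ∑ i ∈ Finset.range n, W (i + 1) ≤ 2 :=
      hΓ.sum_hull_le_two hA hB hAB h0 hδ hclose 1
    rw [t₁, t₂] at hsum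
    nlinarith [mul_le_mul_of_nonneg_left w₁ hL, mul_le_mul_of_nonneg_left w₂ hL]
  intro a b hab
  rcases lt_trichotomy a b with h | h | h
  · exact absurd hab (hlt a b h)
  · exact h
  · exact absurd hab.symm (hlt b a h)

end Denjoy


/-! ### The firing map -/

/-- The primitive of `(f u - σ) exp (σ u)` vanishing at `0`. -/
noncomputable def firingPrimitive (σ : ℝ) (f : ℝ → ℝ) (t : ℝ) : ℝ :=
  ∫ u in (0 : ℝ)..t, (f u - σ) * Real.exp (σ * u)

section Firing

variable {σ : ℝ} {f : ℝ → ℝ}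

theorem intervalIntegrable_firing (hf : LocallyIntegrable f volume) (σ a b : ℝ) :
    IntervalIntegrable (fun u => (f u - σ) * Real.exp (σ * u)) volume a b :=
  (((hf.integrableOn_isCompact isCompact_uIcc).intervalIntegrable (a := a) (b := b)).sub
    intervalIntegrable_const).mul_continuousOn (by fun_prop)

theorem integral_firing (hf : LocallyIntegrable f volume) (σ a b : ℝ) :
    ∫ u in a..b, (f u - σ) * Real.exp (σ * u) = firingPrimitive σ f b - firingPrimitive σ f a :=
  (intervalIntegral.integral_interval_sub_left (intervalIntegrable_firing hf σ 0 b)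
    (intervalIntegrable_firing hf σ 0 a)).symm

theorem continuous_firingPrimitive (hf : LocallyIntegrable f volume) :
    Continuous (firingPrimitive σ f) :=
  intervalIntegral.continuous_primitive (fun a b => intervalIntegrable_firing hf σ a b) 0

theorem strictMono_firingPrimitive (hf : LocallyIntegrable f volume)
    (hpos : ∀ᵐ t : ℝ, 0 < f t - σ) : StrictMono (firingPrimitive σ f) := by
  intro a b hab
  rw [← sub_pos, ← integral_firing hf]
  have hpos' : ∀ᵐ t : ℝ, 0 < (f t - σ) * Real.exp (σ * t) := by
    filter_upwards [hpos] with t ht using mul_pos ht (Real.exp_pos _)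
  rw [intervalIntegral.integral_pos_iff_support_of_nonneg_ae
    (hpos'.mono fun _ h => h.le) (intervalIntegrable_firing hf σ a b)]
  refine ⟨hab, ?_⟩
  have : (Function.support fun t => (f t - σ) * Real.exp (σ * t)) =ᵐ[volume] univ :=
    eventuallyEq_univ.mpr (hpos'.mono fun _ h => h.ne')
  rw [measure_congr (this.inter (ae_eq_refl (Ioc a b))), univ_inter, Real.volume_Ioc]
  simpa using hab

/-- Shifting the variable by one period multiplies the weight by exp σ. -/
theorem firingPrimitive_add_one (hf : LocallyIntegrable f volume)
    (hper : ∀ᵐ t : ℝ, f (t + 1) = f t) (t : ℝ) :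
    firingPrimitive σ f (t + 1) = Real.exp σ * firingPrimitive σ f t + firingPrimitive σ f 1 := by
  have h := integral_firing hf σ 1 (t + 1)
  have h' := intervalIntegral.integral_comp_add_right (a := 0) (b := t)
    (fun u => (f u - σ) * Real.exp (σ * u)) 1
  rw [zero_add] at h'
  rw [← h'] at h
  have e : ∫ u in (0 : ℝ)..t, (f (u + 1) - σ) * Real.exp (σ * (u + 1)) =
      Real.exp σ * firingPrimitive σ f t := by
    rw [firingPrimitive, ← intervalIntegral.integral_const_mul]
    refine intervalIntegral.integral_congr_ae ?_
    filter_upwards [hper] with u hu _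
    rw [hu, mul_add, mul_one, Real.exp_add]
    ring
  linarith

theorem firingPrimitive_unbounded (hσ : 0 ≤ σ) (hf : LocallyIntegrable f volume)
    (hper : ∀ᵐ t : ℝ, f (t + 1) = f t) (hpos : ∀ᵐ t : ℝ, 0 < f t - σ) (y : ℝ) :
    ∃ t, y ≤ firingPrimitive σ f t := by
  have h0 : firingPrimitive σ f 0 = 0 := intervalIntegral.integral_same
  have h1 : 0 < firingPrimitive σ f 1 := by
    rw [← h0]; exact strictMono_firingPrimitive hf hpos one_pos
  have hn : ∀ n : ℕ, n * firingPrimitive σ f 1 ≤ firingPrimitive σ f n := by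
    intro n
    induction n with
    | zero => simp [h0]
    | succ n ih =>
      push_cast
      rw [firingPrimitive_add_one hf hper]
      have : (0 : ℝ) ≤ n * firingPrimitive σ f 1 := by positivity
      nlinarith [Real.one_le_exp hσ]
  obtain ⟨n, h⟩ := Archimedean.arch y h1
  exact ⟨n, h.trans (by rw [nsmul_eq_mul]; exact hn n)⟩

/-- The set in the definition of `firingMap` is a closed half-line whose endpoint solves this
equation. All regularity of the firing map is read off from it. -/
theorem firingPrimitive_firingMap (hσ : 0 ≤ σ) (hf : LocallyIntegrable f volume)
    (hper : ∀ᵐ t : ℝ, f (t + 1) = f t) (hpos : ∀ᵐ t : ℝ, 0 < f t - σ) (t : ℝ) :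
    firingPrimitive σ f (firingMap σ f t) = firingPrimitive σ f t + Real.exp (σ * t) := by
  have hmono := strictMono_firingPrimitive hf hpos
  obtain ⟨b, hb⟩ := firingPrimitive_unbounded hσ hf hper hpos
    (firingPrimitive σ f t + Real.exp (σ * t))
  have hexp := Real.exp_pos (σ * t)
  obtain ⟨s, hs⟩ := mem_range_of_exists_le_of_exists_ge (continuous_firingPrimitive hf)
    ⟨t, show firingPrimitive σ f t ≤ firingPrimitive σ f t + Real.exp (σ * t) by linarith⟩ ⟨b, hb⟩
  have hts : t < s := hmono.lt_iff_lt.mp (by linarith)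
  have hset : {s : ℝ | t < s ∧ Real.exp (σ * t) ≤ ∫ u in t..s, (f u - σ) * Real.exp (σ * u)} =
      Ici s := by
    ext x
    rw [mem_ofPred_eq, integral_firing hf, mem_Ici, ← hmono.le_iff_le (a := s), hs]
    constructor
    · rintro ⟨-, h⟩; linarith
    · intro h
      exact ⟨hmono.lt_iff_lt.mp (by linarith), by linarith⟩
  rw [firingMap, hset, csInf_Ici, hs]

/-- The firing map of a periodically driven leaky integrate-and-fire model lifts a circle
homeomorphism. -/
theorem isCircleHomeoLift_firingMap (hσ : 0 ≤ σ) (hf : LocallyIntegrable f volume)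
    (hper : ∀ᵐ t : ℝ, f (t + 1) = f t) (hpos : ∀ᵐ t : ℝ, 0 < f t - σ) :
    IsCircleHomeoLift (firingMap σ f) := by
  have hmono := strictMono_firingPrimitive hf hpos
  have hcont := continuous_firingPrimitive (σ := σ) hf
  have hF := firingPrimitive_firingMap hσ hf hper hpos
  refine ⟨?_, fun a b hab => hmono.lt_iff_lt.mp ?_, fun t => hmono.injective ?_⟩
  -- The primitive is a topological embedding, so continuity need only be checked after composing
  -- with it.
  · have hemb := hmono.isEmbedding_of_ordConnected
      (isPreconnected_range hcont).ordConnected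
    rw [hemb.continuous_iff]
    simp only [Function.comp_def, hF]
    fun_prop
  · rw [hF, hF]
    have h₁ := hmono hab
    have h₂ : Real.exp (σ * a) ≤ Real.exp (σ * b) :=
      Real.exp_le_exp.mpr (mul_le_mul_of_nonneg_left hab.le hσ)
    linarith
  · rw [hF, firingPrimitive_add_one hf hper, firingPrimitive_add_one hf hper, hF, mul_add, mul_add,
      mul_one, Real.exp_add]
    ring

/-! ### Smooth inputs -/

/-- The derivative is continuous and 1-periodic, hence bounded. -/
theorem exists_lipschitz_of_map_add_one_const {g : ℝ → ℝ} {κ : ℝ} (hg : ContDiff ℝ 1 g)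
    (h : ∀ t, g (t + 1) = g t + κ) :
    ∃ L : ℝ, 0 ≤ L ∧ ∀ x y, |g x - g y| ≤ L * |x - y| := by
  have hper : ∀ t, deriv g (t + 1) = deriv g t := by
    intro t
    rw [← deriv_comp_add_const, funext h, deriv_add_const]
  have hcont : Continuous (deriv g) := hg.continuous_deriv le_rfl
  obtain ⟨L, hL⟩ := isCompact_Icc.exists_bound_of_continuousOn
    (s := Icc (0 : ℝ) 1) hcont.continuousOn
  have hL' : ∀ t, ‖deriv g t‖ ≤ L := by
    intro t
    obtain ⟨m, hm⟩ := exists_int_add_mem_Icc t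
    have := map_add_int_of_map_add_one_const (F := deriv g) (κ := 0)
      (fun t => by rw [hper, add_zero]) t m
    rw [mul_zero, add_zero] at this
    rw [← this]
    exact hL _ hm
  refine ⟨L, (norm_nonneg _).trans (hL' 0), fun x y => ?_⟩
  exact convex_univ.norm_image_sub_le_of_norm_deriv_le
    (fun x _ => (hg.differentiable one_ne_zero) x) (fun x _ => hL' x) (mem_univ y) (mem_univ x)

theorem isTransitive_phaseMap_of_contDiff (hσ : 0 ≤ σ) (hf : LocallyIntegrable f volume)
    (hper : ∀ᵐ t : ℝ, f (t + 1) = f t) {ρ : ℝ} (hrot : IsRotationNumber (firingMap σ f) ρ)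
    (hρ : Irrational ρ) (hsmooth : ContDiff ℝ 1 f) (hpos : ∀ t, 0 < f t - σ) :
    IsTransitive (phaseMap σ f) := by
  have hpos' : ∀ᵐ t : ℝ, 0 < f t - σ := Eventually.of_forall hpos
  have hΦ := isCircleHomeoLift_firingMap hσ hf hper hpos'
  obtain ⟨Γ, hΓ⟩ := hΦ.exists_isSemiconjLift hrot hρ
  refine hΓ.isTransitive_of_injective hρ hΦ ?_
  have hfpos : ∀ t, 0 < f t := fun t => by linarith [hpos t]
  have hcont := hsmooth.continuous
  have hper' : ∀ t, f (t + 1) = f t := congrFun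
    ((Continuous.ae_eq_iff_eq volume (hcont.comp (continuous_add_const 1)) hcont).mp hper)
  -- p and q are the logarithms of the derivatives of the two sides of P(t) + exp(σt) = P(Φ(t)), the
  -- right one taken with respect to Φ(t). Mean values over [a, b] and [Φ a, Φ b] then give the
  -- distortion formula.
  set p : ℝ → ℝ := fun t => Real.log (f t) + σ * t with hp
  set q : ℝ → ℝ := fun t => Real.log (f t - σ) + σ * t with hq
  have hp₁ : ∀ t, p (t + 1) = p t + σ := fun t => by simp only [hp, hper']; ring
  have hq₁ : ∀ t, q (t + 1) = q t + σ := fun t => by simp only [hq, hper']; ring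
  obtain ⟨L, hL, hpL⟩ := exists_lipschitz_of_map_add_one_const
    (show ContDiff ℝ 1 p from (hsmooth.log fun t => (hfpos t).ne').add (by fun_prop)) hp₁
  obtain ⟨L', hL', hqL⟩ := exists_lipschitz_of_map_add_one_const
    (show ContDiff ℝ 1 q from
      ((hsmooth.sub contDiff_const).log fun t => (hpos t).ne').add (by fun_prop)) hq₁
  refine hΓ.injective_of_lipschitz hρ hΦ (p := p) (q := q) (κ := σ) (L := max L L')
    (hL.trans (le_max_left _ _))
    (fun x y => (hpL x y).trans (mul_le_mul_of_nonneg_right (le_max_left _ _) (abs_nonneg _)))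
    (fun x y => (hqL x y).trans (mul_le_mul_of_nonneg_right (le_max_right _ _) (abs_nonneg _)))
    hp₁ hq₁ fun a b hab => ?_
  have hF : ∀ t, HasDerivAt (firingPrimitive σ f) ((f t - σ) * Real.exp (σ * t)) t := fun t =>
    ((show Continuous fun u => (f u - σ) * Real.exp (σ * u) by
      fun_prop).integral_hasStrictDerivAt 0 t).hasDerivAt
  have hG : ∀ t, HasDerivAt (fun t => firingPrimitive σ f t + Real.exp (σ * t))
      (f t * Real.exp (σ * t)) t := fun t => by
    have h := (hF t).add ((hasDerivAt_id t).const_mul σ).exp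
    rw [mul_one] at h
    exact h.congr_deriv (by simp only [id]; ring)
  have hΦab := hΦ.strictMono hab
  obtain ⟨ξ, hξ, hξ'⟩ := exists_hasDerivAt_eq_slope _ _ hab
    (fun t _ => (hG t).continuousAt.continuousWithinAt) fun t _ => hG t
  obtain ⟨ζ, hζ, hζ'⟩ := exists_hasDerivAt_eq_slope _ _ hΦab
    (fun t _ => (hF t).continuousAt.continuousWithinAt) fun t _ => hF t
  refine ⟨ξ, Ioo_subset_Icc_self hξ, ζ, Ioo_subset_Icc_self hζ, ?_⟩
  have hFΦ := firingPrimitive_firingMap hσ hf hper hpos'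
  rw [hFΦ, hFΦ] at hζ'
  have hab' : 0 < b - a := sub_pos.mpr hab
  have hΦab' : 0 < firingMap σ f b - firingMap σ f a := sub_pos.mpr hΦab
  have e : f ξ * Real.exp (σ * ξ) * (b - a) =
      (f ζ - σ) * Real.exp (σ * ζ) * (firingMap σ f b - firingMap σ f a) := by
    rw [hξ', hζ', div_mul_cancel₀ _ hab'.ne', div_mul_cancel₀ _ hΦab'.ne']
  have := congrArg Real.log e
  rw [Real.log_mul (mul_pos (hfpos ξ) (Real.exp_pos _)).ne' hab'.ne',
    Real.log_mul (mul_pos (hpos ζ) (Real.exp_pos _)).ne' hΦab'.ne',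
    Real.log_mul (hfpos ξ).ne' (Real.exp_pos _).ne', Real.log_mul (hpos ζ).ne' (Real.exp_pos _).ne',
    Real.log_exp, Real.log_exp] at this
  simp only [hp, hq]
  linarith

end Firing

end LIF

theorem mainTheorem4 (σ : ℝ) (hσ : 0 ≤ σ) (f : ℝ → ℝ)
    (hf : LocallyIntegrable f volume)
    (hper : ∀ᵐ t : ℝ, f (t + 1) = f t)
    (hpos : ∀ᵐ t : ℝ, 0 < f t - σ)
    (ρ : ℝ) (hrot : LIF.IsRotationNumber (LIF.firingMap σ f) ρ) (hρ : Irrational ρ) :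
    -- the semi-conjugacy and the minimal set exist, and the latter is unique
    (∃ Γ : ℝ → ℝ, LIF.IsSemiconjLift (LIF.firingMap σ f) ρ Γ) ∧
    (∃! Δ : Set UnitAddCircle, LIF.IsMinimalSet (LIF.phaseMap σ f) Δ) ∧
    -- smooth inputs give a transitive firing phase map
    (ContDiff ℝ 2 f → (∀ t, 0 < f t - σ) → LIF.IsTransitive (LIF.phaseMap σ f)) ∧
    ∀ Γ : ℝ → ℝ, LIF.IsSemiconjLift (LIF.firingMap σ f) ρ Γ →
    ∀ Δ : Set UnitAddCircle, LIF.IsMinimalSet (LIF.phaseMap σ f) Δ →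
      -- the transitive case
      (LIF.IsTransitive (LIF.phaseMap σ f) →
        Function.Bijective Γ ∧
        (∃ a b : ℝ, a ≤ b ∧ LIF.displacement (LIF.firingMap σ f) '' Icc 0 1 = Icc a b) ∧
        LIF.displacement (LIF.firingMap σ f) '' Icc 0 1 = LIF.omegaOn Γ ρ univ '' Icc 0 1 ∧
        ∀ t₀ : ℝ, LIF.DenseSubset (LIF.isiValues (LIF.firingMap σ f) t₀)
          (LIF.displacement (LIF.firingMap σ f) '' Icc 0 1)) ∧
      -- the non-transitive case
      (¬ LIF.IsTransitive (LIF.phaseMap σ f) →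
        (∀ t₀ ∈ LIF.totalLift Δ, LIF.DenseSubset (LIF.isiValues (LIF.firingMap σ f) t₀)
          (LIF.displacement (LIF.firingMap σ f) '' LIF.totalLift Δ)) ∧
        (∃ D : Set UnitAddCircle, D ⊆ Δ ∧ LIF.phaseMap σ f '' D = D ∧
          BijOn (LIF.circleMap Γ) D univ) ∧
        (∀ D : Set UnitAddCircle, D ⊆ Δ → D.Nonempty →
          MapsTo (LIF.phaseMap σ f) D D → InjOn (LIF.circleMap Γ) D →
          LIF.omegaOn Γ ρ (LIF.totalLift D) '' (Γ '' LIF.unitLift D) =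
            LIF.displacement (LIF.firingMap σ f) '' LIF.unitLift D ∧
          LIF.DenseSubset (LIF.omegaOn Γ ρ (LIF.totalLift D) '' (Γ '' LIF.unitLift D))
            (LIF.displacement (LIF.firingMap σ f) '' LIF.totalLift Δ) ∧
          (SurjOn (LIF.circleMap Γ) D univ →
            ((LIF.displacement (LIF.firingMap σ f) '' LIF.totalLift Δ) \
              (LIF.omegaOn Γ ρ (LIF.totalLift D) '' (Γ '' LIF.unitLift D))).Countable)) ∧
        (∀ t₀ : ℝ, t₀ ∉ LIF.totalLift Δ → ∀ t ∈ LIF.totalLift Δ,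
          ∃ n : ℕ → ℕ, StrictMono n ∧ ∀ l : ℕ, 1 ≤ l →
            Tendsto (fun k : ℕ => LIF.isi (LIF.firingMap σ f) l ((LIF.firingMap σ f)^[n k] t₀))
              atTop (𝓝 (LIF.isi (LIF.firingMap σ f) l t)))) := by
  have hΦ := LIF.isCircleHomeoLift_firingMap hσ hf hper hpos
  obtain ⟨Γ₀, hΓ₀⟩ := hΦ.exists_isSemiconjLift hrot hρ
  refine ⟨⟨Γ₀, hΓ₀⟩, ⟨_, hΓ₀.isMinimalSet_image_growthSet hρ hΦ,
    fun Δ hΔ => (hΓ₀.isMinimalSet_iff hρ hΦ).mp hΔ⟩,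
    fun hsmooth hpos' => LIF.isTransitive_phaseMap_of_contDiff hσ hf hper hrot hρ
      (hsmooth.of_le one_le_two) hpos', fun Γ hΓ Δ hΔ => ?_⟩
  -- From here on Δ is accessible through the growth set of the given Γ, which need not be Γ₀.
  have hlift := hΓ.totalLift_eq_growthSet hρ hΦ hΔ
  refine ⟨fun htrans => ?_, fun _ => ?_⟩
  · have hinj := hΓ.injective_of_isTransitive hρ hΦ htrans
    refine ⟨⟨hinj, hΓ.surjective⟩, ⟨_, _, ?_, hΦ.continuous_displacement.continuousOn.image_Icc
      zero_le_one⟩, hΓ.omegaOn_image_Icc hΦ hinj, fun t₀ => ?_⟩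
    · rw [← nonempty_Icc, ← hΦ.continuous_displacement.continuousOn.image_Icc zero_le_one]
      exact (nonempty_Icc.mpr zero_le_one).image _
    · have huniv := hΓ.growthSet_eq_univ hinj
      rw [hΦ.displacement_image_Icc, ← huniv]
      exact hΓ.denseSubset_isiValues hρ hΦ (huniv ▸ mem_univ t₀)
  · rw [hlift]
    refine ⟨fun t₀ ht₀ => hΓ.denseSubset_isiValues hρ hΦ ht₀, ?_,
      fun D hDΔ hne hD hinj => ?_, fun t₀ _ t ht => ?_⟩
    · rw [(hΓ.isMinimalSet_iff hρ hΦ).mp hΔ]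
      exact hΓ.exists_invariant_bijOn hΦ
    · have hDK : LIF.totalLift D ⊆ LIF.growthSet Γ := hlift ▸ fun t ht => hDΔ ht
      have himage := hΓ.omegaOn_image hΦ hD hinj
      rw [himage, hΦ.displacement_image_unitLift]
      refine ⟨rfl, hΓ.denseSubset_displacement_totalLift hρ hΦ hne hD hDK, fun hsurj => ?_⟩
      -- A displacement value missed by D comes from a growth point outside its lift, and there are
      -- countably many of those.
      refine ((LIF.countable_growthSet_diff (hΓ.surjOn_totalLift hsurj)).image
        (LIF.displacement (LIF.firingMap σ f))).mono ?_
      rintro _ ⟨⟨t, ht, rfl⟩, hnot⟩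
      exact ⟨t, ⟨ht, fun htD => hnot ⟨t, htD, rfl⟩⟩, rfl⟩
    · obtain ⟨n, hn, h⟩ := hΓ.exists_strictMono_tendsto_isi hρ hΦ t₀ ht
      exact ⟨n, hn, fun l _ => h l⟩
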